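/- Let $G=(V,E)$, $V=\{1,\dots,N\}$, be a simple undirected connected graph, with neighborhoods $\Omega_i=\{j:\{i,j\}\in E\}$. Let $\theta^\ast\in\mathbb R^M$, and let $\mathbf h_1,\dots,\mathbf h_N\in\mathbb R^M$ be non-zero vectors that span $\mathbb R^M$ (equivalently, $\sum_{i}\mathbf h_i\mathbf h_i^\top$ is invertible). At time $t=0,1,2,\dots$ agent $i$ observes $z_i^t=\mathbf h_i^\top\theta^\ast+n_i^t$. Let $\Psi_{\mathrm c},\Psi_{\mathrm o}:\mathbb R\to\mathbb R$ be two functions, each of which, written $\Psi$, is odd, nondecreasing and bounded, satisfies $\Psi(u)>0$ for $u>0$, is continuous Lebesgue-almost everywhere and piecewise differentiable (differentiable off a set with finitely many points in each bounded interval), and is either discontinuous at $0$ or strictly increasing on $(-c_2,c_2)$ for some $c_2>0$. Let $\boldsymbol\Psi_{\mathrm c}:\mathbb R^M\to\mathbb R^M$ apply $\Psi_{\mathrm c}$ to each coordinate. Let $p_{\mathrm o},p_{\mathrm c}$ be two probability density functions on $\mathbb R$, each of which, written $p$, satisfies $p(u)=p(-u)$ for all $u$, $p(u)>0$ for $|u|\le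 c$ with some $c>0$ (depending on the density), and $\int|u|\,p(u)\,du<\infty$. Suppose that * the observation noises $n_i^t$ ($i\in V$, $t\ge0$) are mutually independent, each with density $p_{\mathrm o}$; * the communication noise vectors $\boldsymbol\xi_{ij}^t\in\mathbb R^M$ ($(i,j)$ an ordered pair with $\{i,j\}\in E$, $t\ge 0$) are mutually independent over all arcs and times, are identically distributed in $t$ for each arc, and each of their coordinates has density $p_{\mathrm c}$. The observation noises and the communication noises may depend on each other, and the second moments of the noises may be infinite. Let $a,b>0$, $\delta\in(1/2,1]$, $\alpha_t=a/(t+1)^\delta$, and, from arbitrary (possibly random) initial vectors $\mathbf x_i^0\in\mathbb R^M$, let $$\mathbf x_i^{t+1}=\mathbf x_i^t-\alpha_t\Big(\frac ba\sum_{j\in\Omega_i}\boldsymbol\Psi_{\mathrm c}\big(\mathbf x_i^t-\mathbf x_j^t+\boldsymbol\xi_{ij}^t\big)-\mathbf h_i\,\Psi_{\mathrm o}\big(z_i^t-\mathbf h_i^\top\mathbf x_i^t\big)\Big),\qquad i\in V,\ t\ge0 .$$ Then, for each agent $i=1,\dots,N$, $\mathbf x_i^t\to\theta^\ast$ almost surely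 as $t\to\infty$. -/

import Mathlib

open MeasureTheory ProbabilityTheory Filter Topology

noncomputable section

/-- `f` is differentiable off a set that has finitely many points in every bounded interval. -/
def PiecewiseDifferentiable (f : ℝ → ℝ) : Prop :=
  ∃ S : Set ℝ, (∀ l r : ℝ, (S ∩ Set.Icc l r).Finite) ∧ ∀ u, u ∉ S → DifferentiableAt ℝ f u

/-- The admissible scalar nonlinearities. -/
structure IsNonlinearity (Ψ : ℝ → ℝ) : Prop where
  odd : ∀ u, Ψ (-u) = -Ψ u
  pos : ∀ u, 0 < u → 0 < Ψ u
  monotone : Monotone Ψ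
  continuous_ae : volume {u : ℝ | ¬ ContinuousAt Ψ u} = 0
  piecewise : PiecewiseDifferentiable Ψ
  bounded : ∃ c₁ : ℝ, 0 < c₁ ∧ ∀ u, |Ψ u| ≤ c₁
  at_zero : ¬ ContinuousAt Ψ 0 ∨ ∃ c₂ : ℝ, 0 < c₂ ∧ StrictMonoOn Ψ (Set.Ioo (-c₂) c₂)

/-- The conditions on a noise density: symmetric, positive near the origin, finite first absolute
moment. No condition is placed on the second moment. -/
structure IsNoiseDensity (p : ℝ → ℝ) : Prop where
  measurable : Measurable p
  nonneg : ∀ u, 0 ≤ p u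
  symm : ∀ u, p (-u) = p u
  pos_near_zero : ∃ c : ℝ, 0 < c ∧ ∀ u, |u| ≤ c → 0 < p u
  first_moment : Integrable (fun u => |u| * p u) volume

/-- The real random variable `X` has probability density function `p` under `μ`. -/
def HasDensity {Ω : Type*} [MeasurableSpace Ω] (μ : Measure Ω) (X : Ω → ℝ) (p : ℝ → ℝ) : Prop :=
  μ.map X = volume.withDensity (fun u => ENNReal.ofReal (p u))

/-- Observation noise: `n t i` is the noise of agent `i` at time `t`. The variables are mutually
independent over all pairs (time, agent), and all have the density `p`. -/
structure IsObservationNoise {Ω : Type*} [MeasurableSpace Ω] (μ : Measure Ω) {N : ℕ}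
    (n : ℕ → Fin N → Ω → ℝ) (p : ℝ → ℝ) : Prop where
  measurable : ∀ t i, Measurable (n t i)
  indep : iIndepFun (fun k : ℕ × Fin N => n k.1 k.2) μ
  hasDensity : ∀ t i, HasDensity μ (n t i) p
  isNoiseDensity : IsNoiseDensity p

/-- Communication noise: `ξ t i j` is the noise at time `t` on the arc from `j` to `i`. Only the
arcs of the graph (its darts, the ordered pairs of adjacent agents) matter. The random vectors are
mutually independent over all pairs (time, arc), identically distributed in time, and every
coordinate has the density `p`. Nothing is required of the joint law of the coordinates of one
vector. -/
structure IsCommunicationNoise {Ω : Type*} [MeasurableSpace Ω] (μ : Measure Ω) {N M : ℕ}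
    (G : SimpleGraph (Fin N)) (ξ : ℕ → Fin N → Fin N → Ω → EuclideanSpace ℝ (Fin M))
    (p : ℝ → ℝ) : Prop where
  measurable : ∀ t i j, G.Adj i j → Measurable (ξ t i j)
  indep : iIndepFun (fun k : ℕ × G.Dart => ξ k.1 k.2.fst k.2.snd) μ
  identDistrib : ∀ t s i j, G.Adj i j → IdentDistrib (ξ t i j) (ξ s i j) μ μ
  hasDensity : ∀ t i j, G.Adj i j → ∀ l : Fin M, HasDensity μ (fun ω => ξ t i j ω l) p
  isNoiseDensity : IsNoiseDensity p

/-- The scalar nonlinearity `Ψ` applied to each coordinate. -/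
def componentwise {M : ℕ} (Ψ : ℝ → ℝ) (y : EuclideanSpace ℝ (Fin M)) :
    EuclideanSpace ℝ (Fin M) :=
  WithLp.toLp 2 (fun l => Ψ (y l))

/-- The step size `α_t = a / (t + 1) ^ δ`. -/
def stepSize (a δ : ℝ) (t : ℕ) : ℝ := a / ((t : ℝ) + 1) ^ δ

/-- The nonlinear consensus+innovations recursion along one realization `z` of the observations
and `ξ` of the communication noises, from the initial estimates `x₀`. -/
def estimate {N M : ℕ} (G : SimpleGraph (Fin N)) [DecidableRel G.Adj] (a b δ : ℝ)
    (Ψc Ψo : ℝ → ℝ) (h : Fin N → EuclideanSpace ℝ (Fin M)) (z : ℕ → Fin N → ℝ)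
    (ξ : ℕ → Fin N → Fin N → EuclideanSpace ℝ (Fin M)) (x₀ : Fin N → EuclideanSpace ℝ (Fin M)) :
    ℕ → Fin N → EuclideanSpace ℝ (Fin M)
  | 0 => x₀
  | t + 1 => fun i =>
      let x := estimate G a b δ Ψc Ψo h z ξ x₀ t
      x i - stepSize a δ t •
        ((b / a) • ∑ j ∈ G.neighborFinset i, componentwise Ψc (x i - x j + ξ t i j)
          - Ψo (z t i - inner ℝ (h i) (x i)) • h i)

end

-- The stacked error `Y` obeys `Y (t+1) = Y t - α t • ∑ k, ψ k t (ℓ k (Y t)) • e k`, with one term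
-- for each coordinate of the message on each arc and one for each agent's observation; `ψ k t` is a
-- nonlinearity shifted by the noise. Averaging the noise replaces `Ψ` by `φ u = ∫ Ψ (u + v) p v`,
-- which is continuous, odd, monotone and positive for `u > 0`. The mean field decreases `‖y‖² / 2`
-- at the rate `dissipation`. This rate vanishes only at `0`, by connectivity and the spanning of
-- the `h i`. Since it grows at least linearly along rays (`dissipation_channel_smul`), it is at
-- least `c * ‖y‖` outside any given ball.
--
-- The passage to the mean field is pathwise. For fixed `u` the series `∑ α t * (ψ k t u - φ u)` has
-- independent, centred, bounded terms with summable variances, so it converges almost surely;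
-- taking `u` rational leaves one null set. As in the Glivenko–Cantelli theorem, monotonicity in `u`
-- then gives the uniform statement `AveragesTo` (`averagesTo_of_cauchySeq`). It holds for all
-- slowly moving sequences at once, so neither the initial vectors nor the dependence between
-- channels matters, and boundedness of `Ψ` replaces any moment bound.
--
-- The rest is deterministic (`recursion_tendsto_zero`). Over a window whose steps sum to about a
-- small `τ`, the error hardly moves, so outside a ball its norm falls by a multiple of `τ`. Since
-- `∑ α t = ∞`, such windows never run out.

-- Uniform averaging from monotonicity

/-- Over late windows, the step-weighted sums of the functions `ψ r`, evaluated along a sequence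
that stays close to `w`, are those of the constant `φ w`, up to a small multiple of the length of
the window and a vanishing error. -/
def AveragesTo (α : ℕ → ℝ) (ψ : ℕ → ℝ → ℝ) (φ : ℝ → ℝ) : Prop :=
  ∀ ε₁ : ℝ, 0 < ε₁ → ∃ ρ : ℝ, 0 < ρ ∧ ∀ ε₂ : ℝ, 0 < ε₂ → ∃ S : ℕ, ∀ s, S ≤ s → ∀ t, s ≤ t →
    ∀ (w : ℝ) (v : ℕ → ℝ), (∀ r ∈ Finset.Ico s t, |v r - w| ≤ ρ) →
      |∑ r ∈ Finset.Ico s t, α r * (ψ r (v r) - φ w)| ≤ ε₁ * ∑ r ∈ Finset.Ico s t, α r + ε₂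

/-- The points of `s` are bracketed by points of a finite set of rationals at distance at least
`ρ`, up to an error `ε` in the values of `φ`; near the extreme values `±L` no bracket is needed. -/
def HasBracketing (φ : ℝ → ℝ) (L ε : ℝ) (s : Set ℝ) : Prop :=
  ∃ ρ : ℝ, 0 < ρ ∧ ∃ F : Finset ℚ, ∀ w ∈ s,
    (L - ε ≤ φ w ∨ ∃ q ∈ F, w + ρ ≤ (q : ℝ) ∧ φ q ≤ φ w + ε) ∧
    (φ w ≤ -L + ε ∨ ∃ q ∈ F, (q : ℝ) ≤ w - ρ ∧ φ w - ε ≤ φ q)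

theorem HasBracketing.mono {φ : ℝ → ℝ} {L ε : ℝ} {s t : Set ℝ} (hst : s ⊆ t)
    (ht : HasBracketing φ L ε t) : HasBracketing φ L ε s := by
  obtain ⟨ρ, hρ, F, hF⟩ := ht
  exact ⟨ρ, hρ, F, fun w hw => hF w (hst hw)⟩

theorem HasBracketing.union {φ : ℝ → ℝ} {L ε : ℝ} {s t : Set ℝ}
    (hs : HasBracketing φ L ε s) (ht : HasBracketing φ L ε t) :
    HasBracketing φ L ε (s ∪ t) := by
  obtain ⟨ρ, hρ, F, hF⟩ := hs
  obtain ⟨ρ', hρ', F', hF'⟩ := ht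
  have h1 := min_le_left ρ ρ'
  have h2 := min_le_right ρ ρ'
  refine ⟨min ρ ρ', lt_min hρ hρ', F ∪ F', fun w hw => ?_⟩
  rcases hw with hw | hw
  · obtain ⟨a, b⟩ := hF w hw
    refine ⟨a.imp_right ?_, b.imp_right ?_⟩
    · rintro ⟨q, hq, h3, h4⟩
      exact ⟨q, Finset.mem_union_left _ hq, by linarith, h4⟩
    · rintro ⟨q, hq, h3, h4⟩
      exact ⟨q, Finset.mem_union_left _ hq, by linarith, h4⟩
  · obtain ⟨a, b⟩ := hF' w hw
    refine ⟨a.imp_right ?_, b.imp_right ?_⟩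
    · rintro ⟨q, hq, h3, h4⟩
      exact ⟨q, Finset.mem_union_right _ hq, by linarith, h4⟩
    · rintro ⟨q, hq, h3, h4⟩
      exact ⟨q, Finset.mem_union_right _ hq, by linarith, h4⟩

theorem hasBracketing_nhds {φ : ℝ → ℝ} {L ε : ℝ} (hφ : Continuous φ) (hε : 0 < ε) (w : ℝ) :
    ∃ t ∈ 𝓝 w, HasBracketing φ L ε t := by
  obtain ⟨d, hd, hφd⟩ := Metric.continuous_iff.1 hφ w (ε / 2) (by linarith)
  obtain ⟨q, hq1, hq2⟩ := exists_rat_btwn (show w + d / 2 < w + d by linarith)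
  obtain ⟨q', hq1', hq2'⟩ := exists_rat_btwn (show w - d < w - d / 2 by linarith)
  have h1 := hφd q (by rw [Real.dist_eq, abs_lt]; constructor <;> linarith)
  have h2 := hφd q' (by rw [Real.dist_eq, abs_lt]; constructor <;> linarith)
  rw [Real.dist_eq, abs_lt] at h1 h2
  refine ⟨Metric.ball w (d / 4), Metric.ball_mem_nhds _ (by linarith), d / 4, by linarith,
    {q, q'}, fun x hx => ?_⟩
  rw [Metric.mem_ball] at hx
  have h3 := hφd x (by linarith)
  rw [Real.dist_eq, abs_lt] at h3 hx
  refine ⟨Or.inr ⟨q, by simp, by linarith, by linarith⟩,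
    Or.inr ⟨q', by simp, by linarith, by linarith⟩⟩

/-- The limits `±L` dispose of the two tails, where a single rational serves as the inner bracket;
the local brackets given by continuity are glued over the compact interval in between. -/
theorem hasBracketing_univ {φ : ℝ → ℝ} {L ε : ℝ} (hφ : Continuous φ) (hm : Monotone φ)
    (htop : Tendsto φ atTop (𝓝 L)) (hbot : Tendsto φ atBot (𝓝 (-L))) (hε : 0 < ε) :
    HasBracketing φ L ε Set.univ := by
  have hle : ∀ u, φ u ≤ L := hm.ge_of_tendsto htop
  have hge : ∀ u, -L ≤ φ u := hm.le_of_tendsto hbot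
  obtain ⟨R, hR⟩ := eventually_atTop.1 (htop.eventually (lt_mem_nhds (show L - ε < L by linarith)))
  obtain ⟨R', hR'⟩ := eventually_atBot.1
    (hbot.eventually (gt_mem_nhds (show -L < -L + ε by linarith)))
  obtain ⟨q, hq, -⟩ := exists_rat_btwn (show R < R + 1 by linarith)
  obtain ⟨q', -, hq'⟩ := exists_rat_btwn (show R' - 1 < R' by linarith)
  have hT : HasBracketing φ L ε (Set.Ici (q + 1 : ℝ)) := by
    refine ⟨1, one_pos, {q}, fun w hw => ?_⟩
    have hw : (q + 1 : ℝ) ≤ w := hw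
    exact ⟨Or.inl (hR w (by linarith)).le,
      Or.inr ⟨q, by simp, by linarith, by linarith [hR q hq.le, hle w]⟩⟩
  have hB : HasBracketing φ L ε (Set.Iic (q' - 1 : ℝ)) := by
    refine ⟨1, one_pos, {q'}, fun w hw => ?_⟩
    have hw : w ≤ (q' - 1 : ℝ) := hw
    exact ⟨Or.inr ⟨q', by simp, by linarith, by linarith [hR' q' hq'.le, hge w]⟩,
      Or.inl (hR' w (by linarith)).le⟩
  have hM : HasBracketing φ L ε (Set.Icc (q' - 1 : ℝ) (q + 1)) := by
    refine isCompact_Icc.induction_on (p := HasBracketing φ L ε)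
      ⟨1, one_pos, ∅, by simp⟩ (fun s t hst ht => ht.mono hst) (fun s t hs ht => hs.union ht) ?_
    intro w _
    obtain ⟨t, ht, h⟩ := hasBracketing_nhds (L := L) hφ hε w
    exact ⟨t, mem_nhdsWithin_of_mem_nhds ht, h⟩
  refine ((hT.union hB).union hM).mono fun w _ => ?_
  rcases le_total (q + 1 : ℝ) w with h | h
  · exact Or.inl (Or.inl h)
  · rcases le_total w (q' - 1 : ℝ) with h' | h'
    · exact Or.inl (Or.inr h')
    · exact Or.inr ⟨h', h⟩

/-- Monotonicity makes convergence of the weighted series at rational points uniform. -/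
theorem averagesTo_of_cauchySeq {α : ℕ → ℝ} {ψ : ℕ → ℝ → ℝ} {φ : ℝ → ℝ} {L : ℝ}
    (hα : ∀ t, 0 ≤ α t) (hψ : ∀ t, Monotone (ψ t)) (hL : ∀ t u, |ψ t u| ≤ L)
    (hφ : Continuous φ) (hm : Monotone φ)
    (htop : Tendsto φ atTop (𝓝 L)) (hbot : Tendsto φ atBot (𝓝 (-L)))
    (hC : ∀ q : ℚ, CauchySeq fun t => ∑ r ∈ Finset.range t, α r * (ψ r q - φ q)) :
    AveragesTo α ψ φ := by
  intro ε₁ hε₁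
  obtain ⟨ρ, hρ, F, hF⟩ := hasBracketing_univ hφ hm htop hbot hε₁
  refine ⟨ρ, hρ, fun ε₂ hε₂ => ?_⟩
  have hS : ∀ q : ℚ, ∃ S : ℕ, ∀ s, S ≤ s → ∀ t, s ≤ t →
      |∑ r ∈ Finset.Ico s t, α r * (ψ r q - φ q)| ≤ ε₂ := by
    intro q
    obtain ⟨S, hS⟩ := Metric.cauchySeq_iff.1 (hC q) ε₂ hε₂
    refine ⟨S, fun s hs t ht => ?_⟩
    -- A window sum is a difference of two partial sums, so the Cauchy property bounds all late
    -- windows at once.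
    rw [Finset.sum_Ico_eq_sub _ ht, ← Real.dist_eq]
    exact (hS t (hs.trans ht) s hs).le
  choose S hS using hS
  refine ⟨F.sup S, fun s hs t ht w v hv => ?_⟩
  have hsF : ∀ q ∈ F, S q ≤ s := fun q hq => (Finset.le_sup hq).trans hs
  have hA : 0 ≤ ∑ r ∈ Finset.Ico s t, α r := Finset.sum_nonneg fun r _ => hα r
  obtain ⟨hup, hlow⟩ := hF w trivial
  rw [abs_le]
  constructor
  -- Without a bracket, `ψ ≥ -L` already suffices. With one, `q ≤ w - ρ ≤ v r`, so `ψ r (v r)` is at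
  -- least `ψ r q`, and `φ q` replaces `φ w` at the cost `ε₁`. The upper bound is symmetric.
  · rcases hlow with h | ⟨q, hq, h1, h2⟩
    · have : ∑ r ∈ Finset.Ico s t, α r * (-ε₁) ≤
          ∑ r ∈ Finset.Ico s t, α r * (ψ r (v r) - φ w) :=
        Finset.sum_le_sum fun r _ => mul_le_mul_of_nonneg_left
          (by linarith [(abs_le.1 (hL r (v r))).1]) (hα r)
      rw [← Finset.sum_mul] at this
      linarith
    · have : ∑ r ∈ Finset.Ico s t, (α r * (ψ r q - φ q) + α r * (-ε₁)) ≤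
          ∑ r ∈ Finset.Ico s t, α r * (ψ r (v r) - φ w) :=
        Finset.sum_le_sum fun r hr => by
          rw [← mul_add]
          refine mul_le_mul_of_nonneg_left ?_ (hα r)
          have := hψ r (show (q : ℝ) ≤ v r by linarith [(abs_le.1 (hv r hr)).1])
          linarith
      rw [Finset.sum_add_distrib, ← Finset.sum_mul] at this
      linarith [(abs_le.1 (hS q s (hsF q hq) t ht)).1]
  · rcases hup with h | ⟨q, hq, h1, h2⟩
    · have : ∑ r ∈ Finset.Ico s t, α r * (ψ r (v r) - φ w) ≤ ∑ r ∈ Finset.Ico s t, α r * ε₁ :=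
        Finset.sum_le_sum fun r _ => mul_le_mul_of_nonneg_left
          (by linarith [(abs_le.1 (hL r (v r))).2]) (hα r)
      rw [← Finset.sum_mul] at this
      linarith
    · have : ∑ r ∈ Finset.Ico s t, α r * (ψ r (v r) - φ w) ≤
          ∑ r ∈ Finset.Ico s t, (α r * (ψ r q - φ q) + α r * ε₁) :=
        Finset.sum_le_sum fun r hr => by
          rw [← mul_add]
          refine mul_le_mul_of_nonneg_left ?_ (hα r)
          have := hψ r (show v r ≤ (q : ℝ) by linarith [(abs_le.1 (hv r hr)).2])
          linarith
      rw [Finset.sum_add_distrib, ← Finset.sum_mul] at this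
      linarith [(abs_le.1 (hS q s (hsF q hq) t ht)).2]

-- Windows of small total step

theorem exists_window {α : ℕ → ℝ} (hα0 : Tendsto α atTop (𝓝 0))
    (hsum : Tendsto (fun t => ∑ r ∈ Finset.range t, α r) atTop atTop) {τ : ℝ} (hτ : 0 < τ) :
    ∃ S : ℕ, ∀ s, S ≤ s → ∃ t, s < t ∧ τ / 2 ≤ ∑ r ∈ Finset.Ico s t, α r ∧
      ∑ r ∈ Finset.Ico s t, α r ≤ τ := by
  obtain ⟨S, hS⟩ := eventually_atTop.1 (hα0.eventually (gt_mem_nhds (half_pos hτ)))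
  refine ⟨S, fun s hs => ?_⟩
  have hex : ∃ m, τ / 2 ≤ ∑ r ∈ Finset.Ico s (s + m), α r := by
    obtain ⟨t, ht⟩ := eventually_atTop.1
      (hsum.eventually_ge_atTop (τ / 2 + ∑ r ∈ Finset.range s, α r))
    refine ⟨t, ?_⟩
    have := ht (s + t) (by omega)
    rw [Finset.sum_Ico_eq_sub _ (by omega)]
    linarith
  classical
  -- The least window reaching `τ / 2` overshoots by at most its last step, which is below `τ / 2`.
  have h1 := Nat.find_spec hex
  set m := Nat.find hex with hm
  have hm0 : m ≠ 0 := by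
    intro h0
    rw [h0] at h1
    simp at h1
    linarith
  obtain ⟨k, hk⟩ := Nat.exists_eq_succ_of_ne_zero hm0
  have h2 : ¬ τ / 2 ≤ ∑ r ∈ Finset.Ico s (s + k), α r := Nat.find_min hex (by omega)
  refine ⟨s + m, by omega, h1, ?_⟩
  rw [hk, Nat.succ_eq_add_one, ← add_assoc, Finset.sum_Ico_succ_top (by omega)]
  have := hS (s + k) (by omega)
  linarith

/-- A sequence whose increments are controlled by the steps, and which decreases by a fixed amount
over every late window that starts outside a ball, is eventually in a larger ball. -/
theorem eventually_le_of_window_decrease {α x : ℕ → ℝ} (hα : ∀ t, 0 ≤ α t) {τ C r d : ℝ}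
    (hC : 0 ≤ C) (hd : 0 < d) (hτr : C * τ ≤ r) {S : ℕ}
    (hwin : ∀ s, S ≤ s → ∃ t, s < t ∧ ∑ r ∈ Finset.Ico s t, α r ≤ τ ∧ (r ≤ x s → x t ≤ x s - d))
    (hinc : ∀ s t, s ≤ t → x t ≤ x s + C * ∑ r ∈ Finset.Ico s t, α r) :
    ∀ᶠ t in atTop, x t ≤ 3 * r := by
  choose! nxt h1 h2 h3 using hwin
  set σ : ℕ → ℕ := fun n => nxt^[n] S with hσ
  have hσs : ∀ n, σ (n + 1) = nxt (σ n) := fun n => Function.iterate_succ_apply' _ _ _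
  have hσS : ∀ n, S ≤ σ n := by
    intro n
    induction n with
    | zero => exact le_rfl
    | succ n ih => rw [hσs]; exact ih.trans (h1 _ ih).le
  have hlt : ∀ n, σ n < σ (n + 1) := fun n => by rw [hσs]; exact h1 _ (hσS n)
  have hbd : ∀ n t, σ n ≤ t → t ≤ σ (n + 1) → x t ≤ x (σ n) + r := by
    intro n t h h'
    have h4 := hinc _ _ h
    have h5 : ∑ r ∈ Finset.Ico (σ n) t, α r ≤ τ :=
      (Finset.sum_le_sum_of_subset_of_nonneg (Finset.Ico_subset_Ico_right h')
        fun i _ _ => hα i).trans (by rw [hσs]; exact h2 _ (hσS n))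
    linarith [mul_le_mul_of_nonneg_left h5 hC]
  -- At window ends, a value above `r` drops by `d`, and a value below `r` rises to at most `2 * r`.
  -- Inside a window another `r` may be added, whence `3 * r`.
  have hind : ∀ n : ℕ, x (σ n) ≤ max (2 * r) (x S - n * d) := by
    intro n
    induction n with
    | zero => simp [hσ]
    | succ n ih =>
      rcases le_or_gt r (x (σ n)) with h | h
      · have := h3 _ (hσS n) h
        rw [hσs]
        rcases le_max_iff.1 ih with h' | h'
        · exact le_max_of_le_left (by linarith)
        · exact le_max_of_le_right (by push_cast; linarith)
      · exact le_max_of_le_left (by linarith [hbd n _ (hlt n).le le_rfl])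
  obtain ⟨n₀, hn₀⟩ := exists_nat_ge ((x S - 2 * r) / d)
  rw [div_le_iff₀ hd] at hn₀
  refine eventually_atTop.2 ⟨σ n₀, fun t ht => ?_⟩
  have hex : ∃ n, n₀ ≤ n ∧ σ n ≤ t ∧ t < σ (n + 1) := by
    induction t, ht using Nat.le_induction with
    | base => exact ⟨n₀, le_rfl, le_rfl, hlt _⟩
    | succ t _ ih =>
      obtain ⟨n, hn, h4, h5⟩ := ih
      rcases Nat.lt_or_ge (t + 1) (σ (n + 1)) with h | h
      · exact ⟨n, hn, by omega, h⟩
      · exact ⟨n + 1, by omega, h, lt_of_le_of_lt h5 (hlt _)⟩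
  obtain ⟨n, hn, h4, h5⟩ := hex
  have h6 : x (σ n) ≤ 2 * r := by
    refine (hind n).trans (max_le le_rfl ?_)
    have : (n₀ : ℝ) * d ≤ n * d := by gcongr
    linarith
  linarith [hbd n t h4 h5.le]

-- Deterministic convergence of the recursion

section Recursion

variable {H K : Type*} [NormedAddCommGroup H] [InnerProductSpace ℝ H] [Fintype K]

theorem recursion_sub_eq {α : ℕ → ℝ} {ℓ : K → H →L[ℝ] ℝ} {e : K → H} {ψ : K → ℕ → ℝ → ℝ}
    {Y : ℕ → H} (hY : ∀ t, Y (t + 1) = Y t - α t • ∑ k, ψ k t (ℓ k (Y t)) • e k)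
    {s t : ℕ} (hst : s ≤ t) :
    Y t = Y s - ∑ k, (∑ r ∈ Finset.Ico s t, α r * ψ k r (ℓ k (Y r))) • e k := by
  induction t, hst using Nat.le_induction with
  | base => simp
  | succ t hst ih =>
    rw [hY, ih, sub_sub, Finset.smul_sum, ← Finset.sum_add_distrib]
    congr 1
    refine Finset.sum_congr rfl fun k _ => ?_
    rw [Finset.sum_Ico_succ_top hst, add_smul, ← ih, mul_smul]

theorem norm_recursion_sub_le {α : ℕ → ℝ} (hα : ∀ t, 0 ≤ α t) {ℓ : K → H →L[ℝ] ℝ} {e : K → H}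
    {ψ : K → ℕ → ℝ → ℝ} {L : ℝ} (hL : ∀ k t u, |ψ k t u| ≤ L)
    {Y : ℕ → H} (hY : ∀ t, Y (t + 1) = Y t - α t • ∑ k, ψ k t (ℓ k (Y t)) • e k)
    {s t : ℕ} (hst : s ≤ t) :
    ‖Y t - Y s‖ ≤ (∑ k, L * ‖e k‖) * ∑ r ∈ Finset.Ico s t, α r := by
  rw [recursion_sub_eq hY hst, sub_sub_cancel_left, norm_neg, Finset.sum_mul]
  refine (norm_sum_le _ _).trans (Finset.sum_le_sum fun k _ => ?_)
  rw [norm_smul, Real.norm_eq_abs, mul_right_comm]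
  refine mul_le_mul_of_nonneg_right ?_ (norm_nonneg _)
  refine (Finset.abs_sum_le_sum_abs _ _).trans ?_
  rw [Finset.mul_sum]
  refine Finset.sum_le_sum fun r _ => ?_
  rw [abs_mul, abs_of_nonneg (hα r), mul_comm]
  exact mul_le_mul_of_nonneg_right (hL _ _ _) (hα r)

/-- The rate at which the mean field decreases half of the squared norm. -/
def dissipation (ℓ : K → H →L[ℝ] ℝ) (e : K → H) (φ : K → ℝ → ℝ) (y : H) : ℝ :=
  ∑ k, φ k (ℓ k y) * inner ℝ y (e k)

/-- A positive continuous function has a positive minimum on the sphere of radius `r`; `hscale`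
carries it outward along rays with linear growth. -/
theorem exists_mul_norm_le_dissipation [FiniteDimensional ℝ H] {ℓ : K → H →L[ℝ] ℝ} {e : K → H}
    {φ : K → ℝ → ℝ} (hφ : ∀ k, Continuous (φ k))
    (hscale : ∀ (c : ℝ) (y : H), 1 ≤ c → c * dissipation ℓ e φ y ≤ dissipation ℓ e φ (c • y))
    (hpos : ∀ y, y ≠ 0 → 0 < dissipation ℓ e φ y) {r : ℝ} (hr : 0 < r) :
    ∃ c, 0 < c ∧ ∀ y, r ≤ ‖y‖ → c * ‖y‖ ≤ dissipation ℓ e φ y := by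
  have : ProperSpace H := FiniteDimensional.proper ℝ H
  have hcont : Continuous (dissipation ℓ e φ) := by
    unfold dissipation
    refine continuous_finsetSum _ fun k _ => ?_
    exact ((hφ k).comp (ℓ k).continuous).mul (continuous_id.inner continuous_const)
  have hmin : ∃ c, 0 < c ∧ ∀ y ∈ Metric.sphere (0 : H) r, c ≤ dissipation ℓ e φ y := by
    rcases (Metric.sphere (0 : H) r).eq_empty_or_nonempty with h | h
    · exact ⟨1, one_pos, by simp [h]⟩
    · obtain ⟨y, hy, hmin⟩ := (isCompact_sphere (0 : H) r).exists_isMinOn h hcont.continuousOn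
      refine ⟨_, hpos y ?_, fun z hz => hmin hz⟩
      rintro rfl
      simp at hy
      linarith
  obtain ⟨c, hc, hmin⟩ := hmin
  refine ⟨c / r, div_pos hc hr, fun y hy => ?_⟩
  have hy0 : 0 < ‖y‖ := hr.trans_le hy
  have h1 := hscale (‖y‖ / r) ((r / ‖y‖) • y) ((one_le_div hr).2 hy)
  rw [smul_smul, div_mul_div_cancel₀ hr.ne', div_self hy0.ne', one_smul] at h1
  have h2 := hmin ((r / ‖y‖) • y) (by
    rw [mem_sphere_zero_iff_norm, norm_smul, Real.norm_eq_abs, abs_of_pos (by positivity),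
      div_mul_cancel₀ _ hy0.ne'])
  calc c / r * ‖y‖ = ‖y‖ / r * c := by ring
    _ ≤ _ := mul_le_mul_of_nonneg_left h2 (by positivity)
    _ ≤ _ := h1

theorem AveragesTo.exists_uniform {α : ℕ → ℝ} {ψ : K → ℕ → ℝ → ℝ} {φ : K → ℝ → ℝ}
    (h : ∀ k, AveragesTo α (ψ k) (φ k)) (ε₁ : ℝ) (hε₁ : 0 < ε₁) :
    ∃ ρ : ℝ, 0 < ρ ∧ ∀ ε₂ : ℝ, 0 < ε₂ → ∃ S : ℕ, ∀ s, S ≤ s → ∀ t, s ≤ t →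
      ∀ (k : K) (w : ℝ) (v : ℕ → ℝ), (∀ r ∈ Finset.Ico s t, |v r - w| ≤ ρ) →
        |∑ r ∈ Finset.Ico s t, α r * (ψ k r (v r) - φ k w)| ≤
          ε₁ * ∑ r ∈ Finset.Ico s t, α r + ε₂ := by
  choose ρ hρ hS using fun k => h k ε₁ hε₁
  obtain ⟨ρ₀, hρ₀, hle⟩ : ∃ ρ₀ : ℝ, 0 < ρ₀ ∧ ∀ k, ρ₀ ≤ ρ k := by
    rcases isEmpty_or_nonempty K with hK | hK
    · exact ⟨1, one_pos, fun k => hK.elim k⟩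
    · obtain ⟨k, hk⟩ := Finite.exists_min ρ
      exact ⟨ρ k, hρ k, hk⟩
  refine ⟨ρ₀, hρ₀, fun ε₂ hε₂ => ?_⟩
  choose S hS using fun k => hS k ε₂ hε₂
  exact ⟨Finset.univ.sup S, fun s hs t ht k w v hv =>
    hS k s ((Finset.le_sup (Finset.mem_univ k)).trans hs) t ht w v
      fun r hr => (hv r hr).trans (hle k)⟩

/-- Over a window, the squared norm changes as under the mean field, up to small errors. -/
theorem norm_sq_recursion_le {α : ℕ → ℝ} {ℓ : K → H →L[ℝ] ℝ} {e : K → H}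
    {ψ : K → ℕ → ℝ → ℝ} {φ : K → ℝ → ℝ}
    {Y : ℕ → H} (hY : ∀ t, Y (t + 1) = Y t - α t • ∑ k, ψ k t (ℓ k (Y t)) • e k)
    {s t : ℕ} (hst : s ≤ t) {η : ℝ}
    (hη : ∀ k, |∑ r ∈ Finset.Ico s t, α r * (ψ k r (ℓ k (Y r)) - φ k (ℓ k (Y s)))| ≤ η) :
    ‖Y t‖ ^ 2 ≤ ‖Y s‖ ^ 2 - 2 * (∑ r ∈ Finset.Ico s t, α r) * dissipation ℓ e φ (Y s)
      + 2 * ‖Y s‖ * ((∑ k, ‖e k‖) * η) + ‖Y t - Y s‖ ^ 2 := by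
  have h1 : ‖Y t‖ ^ 2 = ‖Y s‖ ^ 2 + 2 * inner ℝ (Y s) (Y t - Y s) + ‖Y t - Y s‖ ^ 2 := by
    rw [← norm_add_sq_real, add_sub_cancel]
  have h2 : inner ℝ (Y s) (Y t - Y s) = -((∑ r ∈ Finset.Ico s t, α r) * dissipation ℓ e φ (Y s))
      - ∑ k, (∑ r ∈ Finset.Ico s t, α r * (ψ k r (ℓ k (Y r)) - φ k (ℓ k (Y s)))) *
        inner ℝ (Y s) (e k) := by
    rw [recursion_sub_eq hY hst, sub_sub_cancel_left, inner_neg_right, inner_sum, dissipation,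
      Finset.mul_sum, neg_sub_left, ← Finset.sum_add_distrib]
    congr 1
    refine Finset.sum_congr rfl fun k _ => ?_
    simp only [mul_sub, Finset.sum_sub_distrib, inner_smul_right, ← Finset.sum_mul]
    ring
  have h3 : -(∑ k, (∑ r ∈ Finset.Ico s t, α r * (ψ k r (ℓ k (Y r)) - φ k (ℓ k (Y s)))) *
        inner ℝ (Y s) (e k)) ≤ ‖Y s‖ * ((∑ k, ‖e k‖) * η) := by
    rw [← Finset.sum_neg_distrib, Finset.sum_mul, Finset.mul_sum]
    refine Finset.sum_le_sum fun k _ => ?_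
    refine (neg_le_abs _).trans ?_
    rw [abs_mul]
    calc _ ≤ η * (‖Y s‖ * ‖e k‖) :=
          mul_le_mul (hη k) (abs_real_inner_le_norm _ _) (abs_nonneg _)
            ((abs_nonneg _).trans (hη k))
      _ = _ := by ring
  rw [h1, h2]
  linarith

/-- Pathwise convergence of a recursion whose averaged drift dissipates the squared norm. -/
theorem recursion_tendsto_zero [FiniteDimensional ℝ H] {α : ℕ → ℝ} (hα : ∀ t, 0 ≤ α t)
    (hα0 : Tendsto α atTop (𝓝 0))
    (hsum : Tendsto (fun t => ∑ r ∈ Finset.range t, α r) atTop atTop)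
    {ℓ : K → H →L[ℝ] ℝ} {e : K → H} {ψ : K → ℕ → ℝ → ℝ} {φ : K → ℝ → ℝ}
    (hφ : ∀ k, Continuous (φ k)) {L : ℝ} (hL : ∀ k t u, |ψ k t u| ≤ L)
    (havg : ∀ k, AveragesTo α (ψ k) (φ k))
    (hscale : ∀ (c : ℝ) (y : H), 1 ≤ c → c * dissipation ℓ e φ y ≤ dissipation ℓ e φ (c • y))
    (hpos : ∀ y, y ≠ 0 → 0 < dissipation ℓ e φ y)
    {Y : ℕ → H} (hY : ∀ t, Y (t + 1) = Y t - α t • ∑ k, ψ k t (ℓ k (Y t)) • e k) :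
    Tendsto Y atTop (𝓝 0) := by
  suffices key : ∀ r : ℝ, 0 < r → ∀ᶠ t in atTop, ‖Y t‖ ≤ 3 * r by
    rw [tendsto_zero_iff_norm_tendsto_zero, Metric.tendsto_nhds]
    intro ε hε
    filter_upwards [key (ε / 6) (by linarith)] with t ht
    rw [dist_zero_right, norm_norm]
    linarith
  intro r hr
  obtain ⟨c, hc, hD⟩ := exists_mul_norm_le_dissipation hφ hscale hpos hr
  -- The added `1` in `E`, `C` and `B` keeps them positive even when the sums vanish.
  set E : ℝ := ∑ k, ‖e k‖ + 1 with hE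
  have hE0 : 0 ≤ ∑ k, ‖e k‖ := Finset.sum_nonneg fun k _ => norm_nonneg _
  have hE1 : 0 < E := by linarith
  set C : ℝ := |∑ k, L * ‖e k‖| + 1 with hCdef
  have hC : 0 < C := by positivity
  set B : ℝ := ∑ k, ‖ℓ k‖ + 1 with hB
  have hBk : ∀ k, ‖ℓ k‖ ≤ B := fun k => by
    have := Finset.single_le_sum (f := fun k => ‖ℓ k‖) (fun k _ => norm_nonneg _)
      (Finset.mem_univ k)
    linarith
  have hB0 : 0 < B := by
    have : 0 ≤ ∑ k, ‖ℓ k‖ := Finset.sum_nonneg fun k _ => norm_nonneg _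
    linarith
  have hmove : ∀ s t, s ≤ t → ‖Y t - Y s‖ ≤ C * ∑ r ∈ Finset.Ico s t, α r := fun s t hst =>
    (norm_recursion_sub_le hα hL hY hst).trans (mul_le_mul_of_nonneg_right
      (by linarith [le_abs_self (∑ k, L * ‖e k‖)]) (Finset.sum_nonneg fun _ _ => hα _))
  obtain ⟨ρ, hρ, hρS⟩ := AveragesTo.exists_uniform havg (c / (4 * E)) (by positivity)
  -- The four bounds, in order: the norm moves by at most `r` in a window; each readout stays within
  -- `ρ`; the quadratic term is at most a quarter of the main decrease; the number squared in `h7`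
  -- is nonnegative. The radius `ρ` does not depend on `ε₂`, so `ε₂` may be chosen after `τ`.
  obtain ⟨τ, hτ, hτ1, hτ2, hτ3, hτ4⟩ : ∃ τ : ℝ, 0 < τ ∧ C * τ ≤ r ∧ B * (C * τ) ≤ ρ ∧
      C ^ 2 * τ ≤ c * r / 2 ∧ c * τ / 4 ≤ r := by
    have h : ∀ a b : ℝ, 0 < a → 0 < b → ∀ᶠ τ in 𝓝[>] (0 : ℝ), a * τ ≤ b := by
      intro a b ha hb
      filter_upwards [Ioo_mem_nhdsGT (show 0 < b / a by positivity)] with τ hτ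
      have := (lt_div_iff₀ ha).1 hτ.2
      linarith
    obtain ⟨τ, ⟨⟨⟨h1, h2⟩, h3⟩, h4⟩, h5⟩ := ((((h C r hC hr).and (h (B * C) ρ (by positivity) hρ)).and
      (h (C ^ 2) (c * r / 2) (by positivity) (by positivity))).and
      (h (c / 4) r (by positivity) hr)).and self_mem_nhdsWithin |>.exists
    exact ⟨τ, h5, h1, by linarith, h3, by linarith⟩
  obtain ⟨S₁, hS₁⟩ := hρS (c * τ / (8 * E)) (by positivity)
  obtain ⟨S₂, hS₂⟩ := exists_window hα0 hsum hτ
  refine eventually_le_of_window_decrease (x := fun t => ‖Y t‖) (S := max S₁ S₂) hα hC.le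
    (show 0 < c * τ / 8 by positivity) hτ1 (fun s hs => ?_) (fun s t hst => ?_)
  · obtain ⟨t, hst, hA1, hA2⟩ := hS₂ s ((le_max_right _ _).trans hs)
    refine ⟨t, hst, hA2, fun hrs => ?_⟩
    have hsum' := fun k => hS₁ s ((le_max_left _ _).trans hs) t hst.le k (ℓ k (Y s))
      (fun r => ℓ k (Y r)) (fun q hq => by
        rw [← map_sub, ← Real.norm_eq_abs]
        refine ((ℓ k).le_opNorm _).trans ((mul_le_mul (hBk k) ?_ (norm_nonneg _) hB0.le).trans hτ2)
        rw [Finset.mem_Ico] at hq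
        refine (hmove s q hq.1).trans (mul_le_mul_of_nonneg_left ?_ hC.le)
        exact (Finset.sum_le_sum_of_subset_of_nonneg (Finset.Ico_subset_Ico_right hq.2.le)
          fun i _ _ => hα i).trans hA2)
    have hmain := norm_sq_recursion_le hY hst.le hsum'
    have hm := hmove s t hst.le
    have hDs := hD (Y s) hrs
    set A := ∑ r ∈ Finset.Ico s t, α r with hA
    have hA0 : 0 < A := by linarith
    -- Since `τ / 2 ≤ A`, the averaging error costs at most half of the decrease `2 * A * c * ‖Y
    -- s‖`.
    have h1 : (∑ k, ‖e k‖) * (c / (4 * E) * A + c * τ / (8 * E)) ≤ c * A / 2 := by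
      calc (∑ k, ‖e k‖) * (c / (4 * E) * A + c * τ / (8 * E))
          ≤ E * (c / (4 * E) * A + c * τ / (8 * E)) :=
            mul_le_mul_of_nonneg_right (by linarith) (by positivity)
        _ = c * A / 4 + c * τ / 8 := by field_simp
        _ ≤ _ := by nlinarith
    have h2 : ‖Y t - Y s‖ ^ 2 ≤ A * (c * r / 2) := by
      calc ‖Y t - Y s‖ ^ 2 ≤ (C * A) ^ 2 := pow_le_pow_left₀ (norm_nonneg _) hm 2
        _ = A * (C ^ 2 * A) := by ring
        _ ≤ A * (C ^ 2 * τ) := by gcongr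
        _ ≤ _ := by gcongr
    have h3 : A * (c * r / 2) ≤ A * (c * ‖Y s‖ / 2) := by gcongr
    have h4 := mul_le_mul_of_nonneg_left h1 (show 0 ≤ 2 * ‖Y s‖ by positivity)
    have h5 := mul_le_mul_of_nonneg_left hDs (show 0 ≤ 2 * A by positivity)
    have h6 : c * A / 4 ≤ ‖Y s‖ := by
      have : c * A ≤ c * τ := by gcongr
      linarith
    -- What remains is `‖Y s‖ ^ 2 - c * A * ‖Y s‖ / 2`; completing the square gives a drop of the
    -- norm itself.
    have h7 : ‖Y t‖ ^ 2 ≤ (‖Y s‖ - c * A / 4) ^ 2 := by nlinarith [sq_nonneg (c * A / 4)]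
    have h8 := abs_le_of_sq_le_sq h7 (by linarith)
    have h9 : c * τ / 8 ≤ c * A / 4 := by nlinarith
    linarith [le_abs_self ‖Y t‖]
  · have := norm_add_le (Y s) (Y t - Y s)
    rw [add_sub_cancel] at this
    linarith [hmove s t hst]

end Recursion

-- Almost sure convergence of random series, and laws with densities

/-- A series of independent centred bounded random variables with square-summable bounds converges
almost surely. -/
theorem ae_cauchySeq_sum_of_iIndepFun {Ω : Type*} [MeasurableSpace Ω] {μ : Measure Ω}
    [IsProbabilityMeasure μ] {Z : ℕ → Ω → ℝ} (hZm : ∀ t, Measurable (Z t))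
    (hZi : iIndepFun Z μ) {c : ℕ → ℝ} (hZb : ∀ t ω, |Z t ω| ≤ c t)
    (hc : Summable fun t => c t ^ 2) (hZ0 : ∀ t, ∫ ω, Z t ω ∂μ = 0) :
    ∀ᵐ ω ∂μ, CauchySeq fun t => ∑ r ∈ Finset.range t, Z r ω := by
  have hmem : ∀ t, MemLp (Z t) 2 μ := fun t =>
    MemLp.of_bound (hZm t).aestronglyMeasurable (c t) (Eventually.of_forall fun ω => hZb t ω)
  have hint : ∀ t, Integrable (Z t) μ := fun t => (hmem t).integrable (by norm_num)
  have hsm : ∀ t, StronglyMeasurable (Z t) := fun t => (hZm t).stronglyMeasurable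
  set ℱ := Filtration.natural Z hsm with hℱ
  -- The sum runs through index `n`, so that `S n` is adapted to the natural filtration.
  set S : ℕ → Ω → ℝ := fun n => ∑ r ∈ Finset.range (n + 1), Z r with hS
  have hSint : ∀ n, Integrable (S n) μ := fun n => integrable_finsetSum' _ fun r _ => hint r
  have hadp : StronglyAdapted ℱ S := by
    intro n
    refine Finset.stronglyMeasurable_sum _ fun r hr => ?_
    exact (Filtration.stronglyAdapted_natural hsm r).mono
      (ℱ.mono (Nat.lt_succ_iff.1 (Finset.mem_range.1 hr)))
  have hmart : Martingale S ℱ μ := by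
    refine martingale_of_condExp_sub_eq_zero_nat hadp hSint fun n => ?_
    have h1 : S (n + 1) - S n = Z (n + 1) := by
      simp only [hS, Finset.sum_range_succ _ (n + 1), add_sub_cancel_left]
    rw [h1]
    refine (iIndepFun.condExp_natural_ae_eq_of_lt hsm hZi (Nat.lt_succ_self n)).trans ?_
    rw [hZ0]
    rfl
  have hsq : ∀ n, ∫ ω, (S n ω) ^ 2 ∂μ ≤ ∑' t, c t ^ 2 := by
    intro n
    have h0 : ∫ ω, S n ω ∂μ = 0 := by
      simp only [hS, Finset.sum_apply]
      rw [integral_finsetSum _ fun r _ => hint r]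
      exact Finset.sum_eq_zero fun r _ => hZ0 r
    have h1 : Var[S n; μ] = ∫ ω, (S n ω) ^ 2 ∂μ :=
      variance_of_integral_eq_zero (hSint n).aemeasurable h0
    rw [← h1, hS, IndepFun.variance_sum (fun r _ => hmem r)
      fun i _ j _ hij => hZi.indepFun hij]
    refine (Finset.sum_le_sum fun r _ => ?_).trans
      (hc.sum_le_tsum _ fun r _ => sq_nonneg (c r))
    rw [variance_of_integral_eq_zero (hZm r).aemeasurable (hZ0 r)]
    calc ∫ ω, (Z r ω) ^ 2 ∂μ ≤ ∫ _, c r ^ 2 ∂μ := by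
          refine integral_mono (hmem r).integrable_sq (integrable_const _) fun ω => ?_
          exact sq_le_sq.2 ((hZb r ω).trans (le_abs_self _))
      _ = c r ^ 2 := by simp
  have hbdd : ∀ n, eLpNorm (S n) 1 μ ≤ ((1 + ∑' t, c t ^ 2).toNNReal : NNReal) := by
    intro n
    have hmemS : MemLp (S n) 2 μ := memLp_finsetSum' _ fun r _ => hmem r
    rw [eLpNorm_one_eq_lintegral_enorm, ← ofReal_integral_norm_eq_lintegral_enorm (hSint n)]
    refine ENNReal.ofReal_le_ofReal ?_
    calc ∫ ω, ‖S n ω‖ ∂μ ≤ ∫ ω, (1 + (S n ω) ^ 2) ∂μ := by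
          refine integral_mono (hSint n).norm ((integrable_const _).add hmemS.integrable_sq)
            fun ω => ?_
          simp only [Real.norm_eq_abs]
          nlinarith [sq_abs (S n ω), sq_nonneg (|S n ω| - 1), abs_nonneg (S n ω)]
      _ = 1 + ∫ ω, (S n ω) ^ 2 ∂μ := by
          rw [integral_add (integrable_const _) hmemS.integrable_sq]; simp
      _ ≤ _ := by linarith [hsq n]
  filter_upwards [hmart.submartingale.exists_ae_tendsto_of_bdd hbdd] with ω hω
  obtain ⟨x, hx⟩ := hω
  have h2 : Tendsto (fun t => ∑ r ∈ Finset.range t, Z r ω) atTop (𝓝 x) := by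
    rw [← tendsto_add_atTop_iff_nat 1]
    simpa [hS, Finset.sum_apply] using hx
  exact h2.cauchySeq

theorem HasDensity.integral_comp {Ω : Type*} [MeasurableSpace Ω] {μ : Measure Ω} {X : Ω → ℝ}
    {p : ℝ → ℝ} (hX : HasDensity μ X p) (hXm : Measurable X) (hp : IsNoiseDensity p)
    {f : ℝ → ℝ} (hf : Measurable f) : ∫ ω, f (X ω) ∂μ = ∫ v, f v * p v := by
  rw [← integral_map hXm.aemeasurable hf.aestronglyMeasurable, hX,
    integral_withDensity_eq_integral_toReal_smul hp.measurable.ennreal_ofReal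
      (Eventually.of_forall fun _ => ENNReal.ofReal_lt_top)]
  refine integral_congr_ae (Eventually.of_forall fun v => ?_)
  simp [ENNReal.toReal_ofReal (hp.nonneg v), mul_comm]

theorem HasDensity.integrable_integral {Ω : Type*} [MeasurableSpace Ω] {μ : Measure Ω}
    [IsProbabilityMeasure μ] {X : Ω → ℝ}
    {p : ℝ → ℝ} (hX : HasDensity μ X p) (hXm : Measurable X) (hp : IsNoiseDensity p) :
    Integrable p ∧ ∫ v, p v = 1 := by
  have h1 : ∫ v, p v = 1 := by
    have := hX.integral_comp hXm hp (f := fun _ => 1) measurable_const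
    simpa using this.symm
  refine ⟨?_, h1⟩
  -- A non-integrable `p` would have integral `0` by convention, against total mass `1`.
  by_contra h
  rw [integral_undef h] at h1
  exact zero_ne_one h1

-- The nonlinearity averaged over the noise

section SmoothedNonlinearity

/-- The expectation of `Ψ (u + n)` for a noise `n` of density `p`. -/
noncomputable def smoothed (Ψ p : ℝ → ℝ) (u : ℝ) : ℝ := ∫ v, Ψ (u + v) * p v

variable {Ψ p : ℝ → ℝ}

theorem IsNonlinearity.measurable (hΨ : IsNonlinearity Ψ) : Measurable Ψ := hΨ.monotone.measurable

theorem IsNonlinearity.exists_tendsto (hΨ : IsNonlinearity Ψ) :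
    ∃ L, Tendsto Ψ atTop (𝓝 L) ∧ Tendsto Ψ atBot (𝓝 (-L)) ∧ ∀ u, |Ψ u| ≤ L := by
  obtain ⟨c, -, hc⟩ := hΨ.bounded
  have htop : Tendsto Ψ atTop (𝓝 (⨆ u, Ψ u)) := tendsto_atTop_ciSup hΨ.monotone
    ⟨c, by rintro _ ⟨u, rfl⟩; exact (abs_le.1 (hc u)).2⟩
  have hbot : Tendsto Ψ atBot (𝓝 (-⨆ u, Ψ u)) := by
    refine (htop.comp tendsto_neg_atBot_atTop).neg.congr fun u => ?_
    simp [hΨ.odd u]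
  exact ⟨_, htop, hbot, fun u => abs_le.2
    ⟨hΨ.monotone.le_of_tendsto hbot u, hΨ.monotone.ge_of_tendsto htop u⟩⟩

theorem integrable_smoothed (hΨ : IsNonlinearity Ψ) (hp : Integrable p) (u : ℝ) :
    Integrable fun v => Ψ (u + v) * p v := by
  obtain ⟨c, -, hc⟩ := hΨ.bounded
  exact hp.bdd_mul (hΨ.measurable.comp (measurable_const_add u)).aestronglyMeasurable
    (Eventually.of_forall fun v => hc _)

theorem smoothed_odd (hΨ : IsNonlinearity Ψ) (hp : IsNoiseDensity p) (u : ℝ) :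
    smoothed Ψ p (-u) = -smoothed Ψ p u := by
  unfold smoothed
  rw [← integral_neg_eq_self, ← integral_neg]
  refine integral_congr_ae (Eventually.of_forall fun v => ?_)
  simp only
  rw [hp.symm, ← neg_add, hΨ.odd, neg_mul]

theorem smoothed_eq_integral_sub (hp : IsNoiseDensity p) (u : ℝ) :
    smoothed Ψ p u = ∫ v, Ψ (u - v) * p v := by
  unfold smoothed
  rw [← integral_neg_eq_self]
  refine integral_congr_ae (Eventually.of_forall fun v => ?_)
  simp only
  rw [hp.symm, ← sub_eq_add_neg]

theorem smoothed_monotone (hΨ : IsNonlinearity Ψ) (hp : IsNoiseDensity p) (hpi : Integrable p) :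
    Monotone (smoothed Ψ p) := fun u w huw =>
  integral_mono (integrable_smoothed hΨ hpi u) (integrable_smoothed hΨ hpi w) fun v =>
    mul_le_mul_of_nonneg_right (hΨ.monotone (by linarith)) (hp.nonneg v)

/-- For fixed `u`, almost every `v` makes `u + v` a continuity point of `Ψ`, by translation
invariance; dominated convergence then applies even though `Ψ` may jump. -/
theorem smoothed_continuous (hΨ : IsNonlinearity Ψ) (hp : IsNoiseDensity p)
    (hpi : Integrable p) : Continuous (smoothed Ψ p) := by
  obtain ⟨c, -, hc⟩ := hΨ.bounded
  refine continuous_iff_continuousAt.2 fun u => ?_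
  refine continuousAt_of_dominated (bound := fun v => c * p v)
    (Eventually.of_forall fun w => (integrable_smoothed hΨ hpi w).aestronglyMeasurable)
    (Eventually.of_forall fun w => Eventually.of_forall fun v => ?_) (hpi.const_mul c) ?_
  · rw [Real.norm_eq_abs, abs_mul, abs_of_nonneg (hp.nonneg v)]
    exact mul_le_mul_of_nonneg_right (hc _) (hp.nonneg v)
  · have h : ∀ᵐ x : ℝ, ContinuousAt Ψ x := hΨ.continuous_ae
    filter_upwards [(measurePreserving_add_left volume u).quasiMeasurePreserving.ae h] with v hv
    have h2 : ContinuousAt (fun w => Ψ (w + v)) u :=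
      ContinuousAt.comp (f := fun w => w + v) hv (continuous_add_const v).continuousAt
    exact h2.mul continuousAt_const

theorem smoothed_tendsto (hΨ : IsNonlinearity Ψ) (hp : IsNoiseDensity p)
    (hpi : Integrable p) (hp1 : ∫ v, p v = 1) {l : Filter ℝ} [l.IsCountablyGenerated] {L : ℝ}
    (hL : Tendsto Ψ l (𝓝 L)) (hl : ∀ v : ℝ, Tendsto (fun u => u + v) l l) :
    Tendsto (smoothed Ψ p) l (𝓝 L) := by
  obtain ⟨c, -, hc⟩ := hΨ.bounded
  have h : Tendsto (smoothed Ψ p) l (𝓝 (∫ v, L * p v)) := by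
    refine tendsto_integral_filter_of_dominated_convergence (fun v => c * p v)
      (Eventually.of_forall fun w => (integrable_smoothed hΨ hpi w).aestronglyMeasurable)
      (Eventually.of_forall fun w => Eventually.of_forall fun v => ?_) (hpi.const_mul c)
      (Eventually.of_forall fun v => (hL.comp (hl v)).mul_const _)
    rw [Real.norm_eq_abs, abs_mul, abs_of_nonneg (hp.nonneg v)]
    exact mul_le_mul_of_nonneg_right (hc _) (hp.nonneg v)
  rwa [integral_const_mul, hp1, mul_one] at h

/-- By oddness, twice the value is `∫ (Ψ (u + v) - Ψ (-u + v)) * p v`. The integrand is nonnegative,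
and positive for `|v| < min u c`, where the two arguments of `Ψ` have opposite signs. -/
theorem smoothed_pos (hΨ : IsNonlinearity Ψ) (hp : IsNoiseDensity p)
    (hpi : Integrable p) {u : ℝ} (hu : 0 < u) : 0 < smoothed Ψ p u := by
  obtain ⟨c, hc, hpc⟩ := hp.pos_near_zero
  have h2 : 2 * smoothed Ψ p u = ∫ v, (Ψ (u + v) * p v - Ψ (-u + v) * p v) := by
    rw [integral_sub (integrable_smoothed hΨ hpi u) (integrable_smoothed hΨ hpi (-u))]
    have := smoothed_odd hΨ hp u
    unfold smoothed at this ⊢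
    linarith
  have h3 : 0 < ∫ v, (Ψ (u + v) * p v - Ψ (-u + v) * p v) := by
    refine (integral_pos_iff_support_of_nonneg (fun v => ?_)
      ((integrable_smoothed hΨ hpi u).sub (integrable_smoothed hΨ hpi (-u)))).2 ?_
    · rw [Pi.zero_apply, Pi.sub_apply, ← sub_mul]
      exact mul_nonneg (sub_nonneg.2 (hΨ.monotone (by linarith))) (hp.nonneg v)
    · have hsub : Set.Ioo (-min u c) (min u c) ⊆
          Function.support fun v => Ψ (u + v) * p v - Ψ (-u + v) * p v := by
        intro v hv
        have h4 := min_le_left u c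
        have h5 := min_le_right u c
        have hpv : 0 < p v := hpc v (abs_le.2 ⟨by linarith [hv.1], by linarith [hv.2]⟩)
        have h6 : 0 < Ψ (u + v) := hΨ.pos _ (by linarith [hv.1])
        have h7 : 0 < Ψ (-(-u + v)) := hΨ.pos _ (by linarith [hv.2])
        rw [hΨ.odd] at h7
        rw [Function.mem_support, ← sub_mul]
        exact (mul_pos (by linarith) hpv).ne'
      refine lt_of_lt_of_le ?_ (measure_mono hsub)
      rw [Real.volume_Ioo]
      exact ENNReal.ofReal_pos.2 (by linarith [lt_min hu hc])
  linarith

end SmoothedNonlinearity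

-- Odd monotone functions and step sizes

section OddMonotone

variable {φ : ℝ → ℝ}

theorem self_mul_nonneg_of_odd (hodd : ∀ u, φ (-u) = -φ u) (hm : Monotone φ) (u : ℝ) :
    0 ≤ φ u * u := by
  have h0 : φ 0 = 0 := by
    have := hodd 0
    rw [neg_zero] at this
    linarith
  rcases le_total 0 u with h | h
  · exact mul_nonneg (h0 ▸ hm h) h
  · exact mul_nonneg_of_nonpos_of_nonpos (h0 ▸ hm h) h

theorem self_mul_pos_of_odd (hodd : ∀ u, φ (-u) = -φ u) (hpos : ∀ u, 0 < u → 0 < φ u) {u : ℝ}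
    (hu : u ≠ 0) : 0 < φ u * u := by
  rcases hu.lt_or_gt with h | h
  · have := hpos (-u) (by linarith)
    rw [hodd] at this
    exact mul_pos_of_neg_of_neg (by linarith) h
  · exact mul_pos (hpos u h) h

theorem mul_self_mul_le_of_monotone (hm : Monotone φ) {c : ℝ} (hc : 1 ≤ c)
    (u : ℝ) : c * (φ u * u) ≤ φ (c * u) * (c * u) := by
  have key : φ u * u ≤ φ (c * u) * u := by
    rcases le_total 0 u with h | h
    · exact mul_le_mul_of_nonneg_right (hm (by nlinarith)) h
    · exact mul_le_mul_of_nonpos_right (hm (by nlinarith)) h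
  nlinarith

end OddMonotone

section StepSize

variable {a δ : ℝ}

theorem stepSize_nonneg (ha : 0 < a) (t : ℕ) : 0 ≤ stepSize a δ t := by
  unfold stepSize
  positivity

theorem stepSize_eq (t : ℕ) : stepSize a δ t = a * (1 / ((t + 1 : ℕ) : ℝ) ^ δ) := by
  unfold stepSize
  push_cast
  ring

theorem summable_stepSize_sq (hδ : 1 / 2 < δ) : Summable fun t => stepSize a δ t ^ 2 := by
  have h := ((summable_nat_add_iff 1).2 (Real.summable_one_div_nat_rpow.2
    (show 1 < 2 * δ by linarith))).mul_left (a ^ 2)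
  refine h.congr fun t => ?_
  have h2 : ((t + 1 : ℕ) : ℝ) ^ (2 * δ) = (((t + 1 : ℕ) : ℝ) ^ δ) ^ 2 := by
    rw [mul_comm, Real.rpow_mul (by positivity), Real.rpow_two]
  rw [stepSize_eq, h2, mul_pow, one_div_pow]

theorem stepSize_tendsto_zero (hδ : 1 / 2 < δ) : Tendsto (stepSize a δ) atTop (𝓝 0) := by
  have h := (summable_stepSize_sq (a := a) hδ).tendsto_atTop_zero.sqrt
  simp only [Real.sqrt_sq_eq_abs, Real.sqrt_zero] at h
  exact (tendsto_zero_iff_abs_tendsto_zero _).2 h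

theorem stepSize_sum_tendsto_atTop (ha : 0 < a) (hδ : δ ≤ 1) :
    Tendsto (fun t => ∑ r ∈ Finset.range t, stepSize a δ r) atTop atTop := by
  refine (not_summable_iff_tendsto_nat_atTop_of_nonneg fun t => stepSize_nonneg ha t).1 fun h => ?_
  have h2 : Summable fun t : ℕ => 1 / ((t + 1 : ℕ) : ℝ) ^ δ := by
    refine (h.mul_left a⁻¹).congr fun t => ?_
    rw [stepSize_eq, inv_mul_cancel_left₀ ha.ne']
  exact absurd (Real.summable_one_div_nat_rpow.1 ((summable_nat_add_iff 1).1 h2)) (by linarith)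

end StepSize

/-- Independent noises of density `p`, entering with either sign, make the nonlinearity average to
its smoothing, almost surely. -/
theorem ae_averagesTo_smoothed {Ω : Type*} [MeasurableSpace Ω] {μ : Measure Ω}
    [IsProbabilityMeasure μ] {Ψ p : ℝ → ℝ} (hΨ : IsNonlinearity Ψ) (hp : IsNoiseDensity p)
    {X : ℕ → Ω → ℝ} (hXm : ∀ t, Measurable (X t)) (hXi : iIndepFun X μ)
    (hX : ∀ t, HasDensity μ (X t) p) {α : ℕ → ℝ} (hα : ∀ t, 0 ≤ α t)
    (hα2 : Summable fun t => α t ^ 2) {σ : ℝ} (hσ : σ = 1 ∨ σ = -1) :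
    ∀ᵐ ω ∂μ, AveragesTo α (fun t u => Ψ (u + σ * X t ω)) (smoothed Ψ p) := by
  obtain ⟨hpi, hp1⟩ := (hX 0).integrable_integral (hXm 0) hp
  obtain ⟨L, htop, hbot, hL⟩ := hΨ.exists_tendsto
  have hm := smoothed_monotone hΨ hp hpi
  have htop' := smoothed_tendsto hΨ hp hpi hp1 htop
    fun v => tendsto_atTop_add_const_right _ v tendsto_id
  have hbot' := smoothed_tendsto hΨ hp hpi hp1 hbot
    fun v => tendsto_atBot_add_const_right _ v tendsto_id
  -- Rational points are countably many, so the exceptional null sets can be united.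
  have hae : ∀ q : ℚ, ∀ᵐ ω ∂μ, CauchySeq fun t =>
      ∑ r ∈ Finset.range t, α r * (Ψ (q + σ * X r ω) - smoothed Ψ p q) := by
    intro q
    have hfm : Measurable fun v : ℝ => Ψ (q + σ * v) :=
      hΨ.measurable.comp ((measurable_id.const_mul σ).const_add (q : ℝ))
    have hgm : ∀ t, Measurable fun v => α t * (Ψ (q + σ * v) - smoothed Ψ p q) := fun t =>
      (hfm.sub_const _).const_mul _
    refine ae_cauchySeq_sum_of_iIndepFun
      (Z := fun t ω => α t * (Ψ (q + σ * X t ω) - smoothed Ψ p q)) (c := fun t => α t * (2 * L))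
      (fun t => (hgm t).comp (hXm t)) (hXi.comp _ hgm) (fun t ω => ?_)
      ((hα2.mul_right ((2 * L) ^ 2)).congr fun t => by ring) (fun t => ?_)
    · rw [abs_mul, abs_of_nonneg (hα t)]
      refine mul_le_mul_of_nonneg_left (abs_le.2 ?_) (hα t)
      have h1 := abs_le.1 (hL (q + σ * X t ω))
      have h2 := hm.ge_of_tendsto htop' (q : ℝ)
      have h3 := hm.le_of_tendsto hbot' (q : ℝ)
      constructor <;> linarith [h1.1, h1.2]
    · have hint : Integrable (fun ω => Ψ (q + σ * X t ω)) μ :=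
        Integrable.of_bound (hfm.comp (hXm t)).aestronglyMeasurable L
          (Eventually.of_forall fun ω => hL _)
      have h1 : ∫ ω, Ψ (q + σ * X t ω) ∂μ = smoothed Ψ p q := by
        rw [(hX t).integral_comp (hXm t) hp hfm]
        rcases hσ with rfl | rfl
        · simp [smoothed]
        · rw [smoothed_eq_integral_sub hp]
          simp [sub_eq_add_neg]
      rw [integral_const_mul, integral_sub hint (integrable_const _), h1]
      simp
  filter_upwards [ae_all_iff.2 hae] with ω hω
  exact averagesTo_of_cauchySeq hα (fun t u w huw => hΨ.monotone (by linarith))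
    (fun t u => hL _) (smoothed_continuous hΨ hp hpi) hm htop' hbot' hω

-- The network as a recursion with finitely many channels

section Network

variable {N M : ℕ}

/-- The channels through which the stacked estimation error is fed back: the coordinates of the
messages on the arcs, and the scalar observations of the agents. -/
abbrev Channel (G : SimpleGraph (Fin N)) (M : ℕ) : Type := (G.Dart × Fin M) ⊕ Fin N

/-- The linear functional of the stacked error that a channel transmits. -/
noncomputable def readout (G : SimpleGraph (Fin N)) (h : Fin N → EuclideanSpace ℝ (Fin M)) :
    Channel G M → EuclideanSpace ℝ (Fin N × Fin M) →L[ℝ] ℝ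
  | .inl (d, l) => EuclideanSpace.proj (d.fst, l) - EuclideanSpace.proj (d.snd, l)
  | .inr i => ∑ l, h i l • EuclideanSpace.proj (i, l)

/-- The direction in which a channel acts on the stacked error. -/
noncomputable def actuator (G : SimpleGraph (Fin N)) (h : Fin N → EuclideanSpace ℝ (Fin M))
    (κ : ℝ) : Channel G M → EuclideanSpace ℝ (Fin N × Fin M)
  | .inl (d, l) => WithLp.toLp 2 fun p => if p = (d.fst, l) then κ else 0
  | .inr i => WithLp.toLp 2 fun p => if p.1 = i then h i p.2 else 0

variable (G : SimpleGraph (Fin N)) [DecidableRel G.Adj] (h : Fin N → EuclideanSpace ℝ (Fin M))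

theorem sum_dart_fst_eq (i : Fin N) (f : Fin N → Fin N → ℝ) :
    ∑ d : G.Dart, (if d.fst = i then f d.fst d.snd else 0) = ∑ j ∈ G.neighborFinset i, f i j := by
  rw [← Finset.sum_filter, G.dart_fst_fiber i,
    Finset.sum_image fun x _ y _ hxy => G.dartOfNeighborSet_injective i hxy,
    SimpleGraph.neighborFinset]
  exact (Finset.sum_subtype (G.neighborSet i).toFinset (fun _ => Set.mem_toFinset) (f i)).symm

theorem sum_channel_smul_actuator_apply (κ : ℝ) (c : G.Dart → Fin M → ℝ) (g : Fin N → ℝ)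
    (i : Fin N) (l : Fin M) :
    (∑ k : Channel G M, (Sum.elim (fun q : G.Dart × Fin M => c q.1 q.2) g k) •
        actuator G h κ k) (i, l) =
      κ * (∑ d : G.Dart, if d.fst = i then c d l else 0) + g i * h i l := by
  rw [Fintype.sum_sum_type, Fintype.sum_prod_type]
  simp only [Sum.elim_inl, Sum.elim_inr, PiLp.add_apply, WithLp.ofLp_sum, Finset.sum_apply,
    PiLp.smul_apply, smul_eq_mul, actuator, Prod.mk.injEq, mul_ite, mul_zero]
  congr 1
  · rw [Finset.mul_sum]
    refine Finset.sum_congr rfl fun d _ => ?_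
    rw [Finset.sum_eq_single l]
    · by_cases hd : d.fst = i
      · simp [hd, mul_comm]
      · simp [hd, Ne.symm hd]
    · intro l' _ hl'
      simp [Ne.symm hl']
    · simp
  · simp

/-- Reversing every arc and using that `φc` is odd symmetrizes the consensus part; the factor `1 /
2` accounts for both orientations. Every summand then has the form `φ u * u`. -/
theorem dissipation_channel {κ : ℝ} {φc φo : ℝ → ℝ} (hodd : ∀ u, φc (-u) = -φc u)
    (y : EuclideanSpace ℝ (Fin N × Fin M)) :
    dissipation (readout G h) (actuator G h κ) (Sum.elim (fun _ => φc) fun _ => φo) y =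
      κ / 2 * ∑ d : G.Dart, ∑ l, φc (y (d.fst, l) - y (d.snd, l)) * (y (d.fst, l) - y (d.snd, l))
      + ∑ i, φo (∑ l, h i l * y (i, l)) * ∑ l, h i l * y (i, l) := by
  have hflip : ∑ d : G.Dart, ∑ l, φc (y (d.fst, l) - y (d.snd, l)) * y (d.fst, l) =
      -∑ d : G.Dart, ∑ l, φc (y (d.fst, l) - y (d.snd, l)) * y (d.snd, l) := by
    rw [← Finset.sum_neg_distrib,
      ← Equiv.sum_comp (Function.Involutive.toPerm _ SimpleGraph.Dart.symm_involutive)]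
    refine Finset.sum_congr rfl fun d _ => ?_
    rw [← Finset.sum_neg_distrib]
    refine Finset.sum_congr rfl fun l _ => ?_
    simp only [Function.Involutive.coe_toPerm, SimpleGraph.Dart.symm, Prod.fst_swap, Prod.snd_swap]
    rw [← neg_sub, hodd, neg_mul]
  have hc : dissipation (readout G h) (actuator G h κ) (Sum.elim (fun _ => φc) fun _ => φo) y =
      κ * ∑ d : G.Dart, ∑ l, φc (y (d.fst, l) - y (d.snd, l)) * y (d.fst, l)
      + ∑ i, φo (∑ l, h i l * y (i, l)) * ∑ l, h i l * y (i, l) := by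
    rw [dissipation, Fintype.sum_sum_type, Fintype.sum_prod_type]
    congr 1
    · rw [Finset.mul_sum]
      refine Finset.sum_congr rfl fun d _ => ?_
      rw [Finset.mul_sum]
      refine Finset.sum_congr rfl fun l _ => ?_
      simp [readout, actuator, PiLp.inner_apply]
      ring
    · refine Finset.sum_congr rfl fun i _ => ?_
      simp [readout, actuator, PiLp.inner_apply, Fintype.sum_prod_type, Finset.sum_ite_irrel]
  rw [hc]
  simp only [mul_sub, Finset.sum_sub_distrib]
  rw [hflip]
  ring

theorem dissipation_channel_smul {κ : ℝ} (hκ : 0 < κ) {φc φo : ℝ → ℝ}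
    (hcodd : ∀ u, φc (-u) = -φc u) (hcm : Monotone φc) (hom : Monotone φo)
    (c : ℝ) (y : EuclideanSpace ℝ (Fin N × Fin M)) (hc : 1 ≤ c) :
    c * dissipation (readout G h) (actuator G h κ) (Sum.elim (fun _ => φc) fun _ => φo) y ≤
      dissipation (readout G h) (actuator G h κ) (Sum.elim (fun _ => φc) fun _ => φo) (c • y) := by
  rw [dissipation_channel G h hcodd, dissipation_channel G h hcodd, mul_add, mul_left_comm]
  refine add_le_add (mul_le_mul_of_nonneg_left ?_ (by positivity)) ?_
  · rw [Finset.mul_sum]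
    refine Finset.sum_le_sum fun d _ => ?_
    rw [Finset.mul_sum]
    refine Finset.sum_le_sum fun l _ => ?_
    simp only [PiLp.smul_apply, smul_eq_mul, ← mul_sub]
    exact mul_self_mul_le_of_monotone hcm hc _
  · rw [Finset.mul_sum]
    refine Finset.sum_le_sum fun i _ => ?_
    have hlin : ∑ l, h i l * (c • y) (i, l) = c * ∑ l, h i l * y (i, l) := by
      rw [Finset.mul_sum]
      exact Finset.sum_congr rfl fun l _ => mul_left_comm _ _ _
    rw [hlin]
    exact mul_self_mul_le_of_monotone hom hc _

/-- If the sum vanishes, each nonnegative term does. The arc terms force the agents' blocks to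
agree, by connectivity; the observation terms make the common block orthogonal to every `h i`, hence
zero. -/
theorem dissipation_channel_pos (hG : G.Connected) (hspan : Submodule.span ℝ (Set.range h) = ⊤)
    {κ : ℝ} (hκ : 0 < κ) {φc φo : ℝ → ℝ}
    (hcodd : ∀ u, φc (-u) = -φc u) (hcm : Monotone φc) (hcpos : ∀ u, 0 < u → 0 < φc u)
    (hoodd : ∀ u, φo (-u) = -φo u) (hom : Monotone φo) (hopos : ∀ u, 0 < u → 0 < φo u)
    (y : EuclideanSpace ℝ (Fin N × Fin M)) (hy : y ≠ 0) :
    0 < dissipation (readout G h) (actuator G h κ) (Sum.elim (fun _ => φc) fun _ => φo) y := by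
  rw [dissipation_channel G h hcodd]
  have hc0 : ∀ d : G.Dart, 0 ≤
      ∑ l, φc (y (d.fst, l) - y (d.snd, l)) * (y (d.fst, l) - y (d.snd, l)) := fun d =>
    Finset.sum_nonneg fun l _ => self_mul_nonneg_of_odd hcodd hcm _
  have ho0 : ∀ i, 0 ≤ φo (∑ l, h i l * y (i, l)) * ∑ l, h i l * y (i, l) := fun i =>
    self_mul_nonneg_of_odd hoodd hom _
  have hC : 0 ≤ ∑ d : G.Dart, ∑ l,
      φc (y (d.fst, l) - y (d.snd, l)) * (y (d.fst, l) - y (d.snd, l)) :=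
    Finset.sum_nonneg fun d _ => hc0 d
  have hO : 0 ≤ ∑ i, φo (∑ l, h i l * y (i, l)) * ∑ l, h i l * y (i, l) :=
    Finset.sum_nonneg fun i _ => ho0 i
  by_contra hneg
  have hC0 : ∑ d : G.Dart, ∑ l,
      φc (y (d.fst, l) - y (d.snd, l)) * (y (d.fst, l) - y (d.snd, l)) = 0 := by
    by_contra hne
    exact hneg (add_pos_of_pos_of_nonneg (mul_pos (by positivity) (lt_of_le_of_ne hC (Ne.symm hne)))
      hO)
  have hO0 : ∑ i, φo (∑ l, h i l * y (i, l)) * ∑ l, h i l * y (i, l) = 0 := by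
    by_contra hne
    exact hneg (add_pos_of_nonneg_of_pos (by positivity) (lt_of_le_of_ne hO (Ne.symm hne)))
  rw [Finset.sum_eq_zero_iff_of_nonneg fun d _ => hc0 d] at hC0
  rw [Finset.sum_eq_zero_iff_of_nonneg fun i _ => ho0 i] at hO0
  have hadj : ∀ i j, G.Adj i j → ∀ l, y (i, l) = y (j, l) := by
    intro i j hij l
    have h1 := hC0 ⟨(i, j), hij⟩ (Finset.mem_univ _)
    rw [Finset.sum_eq_zero_iff_of_nonneg fun l _ => self_mul_nonneg_of_odd hcodd hcm _] at h1
    by_contra hne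
    exact (self_mul_pos_of_odd hcodd hcpos (sub_ne_zero.2 hne)).ne' (h1 l (Finset.mem_univ _))
  have hobs : ∀ i, ∑ l, h i l * y (i, l) = 0 := by
    intro i
    by_contra hne
    exact (self_mul_pos_of_odd hoodd hopos hne).ne' (hO0 i (Finset.mem_univ _))
  have hconst : ∀ i j l, y (i, l) = y (j, l) := by
    intro i j l
    obtain ⟨w⟩ := hG.preconnected i j
    induction w with
    | nil => rfl
    | cons hij _ ih => exact (hadj _ _ hij l).trans ih
  obtain ⟨i₀⟩ := hG.nonempty
  set v : EuclideanSpace ℝ (Fin M) := WithLp.toLp 2 fun l => y (i₀, l) with hv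
  have hv0 : v = 0 := by
    have h1 : v ∈ (Submodule.span ℝ (Set.range h))ᗮ := by
      rw [Submodule.mem_orthogonal]
      intro u hu
      induction hu using Submodule.span_induction with
      | mem x hx =>
        obtain ⟨i, rfl⟩ := hx
        have := hobs i
        simp only [hconst i i₀] at this
        simpa [PiLp.inner_apply, hv, mul_comm] using this
      | zero => simp
      | add x z _ _ hx hz => rw [inner_add_left, hx, hz, add_zero]
      | smul c x _ hx => rw [inner_smul_left, hx, mul_zero]
    rwa [hspan, Submodule.top_orthogonal_eq_bot, Submodule.mem_bot] at h1
  refine hy ?_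
  ext ⟨i, l⟩
  have := congrArg (fun u : EuclideanSpace ℝ (Fin M) => u l) hv0
  simpa [hv, hconst i i₀] using this

/-- The stacked estimation errors of all agents. -/
noncomputable def stackedError (θ : EuclideanSpace ℝ (Fin M))
    (x : Fin N → EuclideanSpace ℝ (Fin M)) : EuclideanSpace ℝ (Fin N × Fin M) :=
  WithLp.toLp 2 fun p => x p.1 p.2 - θ p.2

/-- The residual `z - ⟪h, x⟫` is minus the readout of the error plus the noise; oddness of `Ψo`
moves the sign outside, which is why observation noise enters with the sign `-1`. -/
theorem stackedError_estimate_succ {a b δ : ℝ} {Ψc Ψo : ℝ → ℝ} (hΨo : IsNonlinearity Ψo)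
    {z n : ℕ → Fin N → ℝ} {θ : EuclideanSpace ℝ (Fin M)}
    (hz : ∀ t i, z t i = inner ℝ (h i) θ + n t i)
    (ξ : ℕ → Fin N → Fin N → EuclideanSpace ℝ (Fin M)) (x₀ : Fin N → EuclideanSpace ℝ (Fin M))
    (t : ℕ) :
    stackedError θ (estimate G a b δ Ψc Ψo h z ξ x₀ (t + 1)) =
      stackedError θ (estimate G a b δ Ψc Ψo h z ξ x₀ t) - stepSize a δ t •
        ∑ k : Channel G M, (Sum.elim
          (fun (q : G.Dart × Fin M) s u => Ψc (u + 1 * ξ s q.1.fst q.1.snd q.2))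
          (fun i s u => Ψo (u + -1 * n s i)) k : ℕ → ℝ → ℝ) t
          (readout G h k (stackedError θ (estimate G a b δ Ψc Ψo h z ξ x₀ t))) •
            actuator G h (b / a) k := by
  set x := estimate G a b δ Ψc Ψo h z ξ x₀ t with hx
  have hsplit : ∑ k : Channel G M, (Sum.elim
          (fun (q : G.Dart × Fin M) s u => Ψc (u + 1 * ξ s q.1.fst q.1.snd q.2))
          (fun i s u => Ψo (u + -1 * n s i)) k : ℕ → ℝ → ℝ) t
          (readout G h k (stackedError θ x)) • actuator G h (b / a) k =
      ∑ k : Channel G M, (Sum.elim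
          (fun q : G.Dart × Fin M => Ψc ((x q.1.fst - x q.1.snd + ξ t q.1.fst q.1.snd) q.2))
          (fun i => -Ψo (z t i - inner ℝ (h i) (x i))) k) • actuator G h (b / a) k := by
    refine Finset.sum_congr rfl fun k _ => ?_
    rcases k with ⟨d, l⟩ | i
    · simp [readout, stackedError]
    · simp only [Sum.elim_inr]
      rw [← hΨo.odd]
      congr 2
      rw [hz]
      simp only [readout, stackedError, sum_apply,
        smul_apply, PiLp.proj_apply, smul_eq_mul, mul_sub,
        Finset.sum_sub_distrib, PiLp.inner_apply, RCLike.inner_apply, conj_trivial]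
      simp only [mul_comm (h i _)]
      ring
  rw [hsplit]
  ext ⟨i, l⟩
  rw [PiLp.sub_apply, PiLp.smul_apply, sum_channel_smul_actuator_apply G h (b / a)
    (fun d l => Ψc ((x d.fst - x d.snd + ξ t d.fst d.snd) l)),
    sum_dart_fst_eq G i fun i j => Ψc ((x i - x j + ξ t i j) l)]
  simp only [stackedError, estimate, ← hx, componentwise, PiLp.sub_apply, PiLp.smul_apply,
    WithLp.ofLp_sum, Finset.sum_apply, smul_eq_mul]
  ring

end Network

-- Almost sure consistency

theorem theorem1 {Ω : Type*} [MeasurableSpace Ω] (μ : Measure Ω) [IsProbabilityMeasure μ]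
    {N M : ℕ} (G : SimpleGraph (Fin N)) [DecidableRel G.Adj] (hG : G.Connected)
    (Ψc Ψo : ℝ → ℝ) (hΨc : IsNonlinearity Ψc) (hΨo : IsNonlinearity Ψo)
    (h : Fin N → EuclideanSpace ℝ (Fin M)) (hh : ∀ i, h i ≠ 0)
    (hspan : Submodule.span ℝ (Set.range h) = ⊤)
    (n : ℕ → Fin N → Ω → ℝ) (po : ℝ → ℝ) (hn : IsObservationNoise μ n po)
    (ξ : ℕ → Fin N → Fin N → Ω → EuclideanSpace ℝ (Fin M)) (pc : ℝ → ℝ)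
    (hξ : IsCommunicationNoise μ G ξ pc)
    (a b δ : ℝ) (ha : 0 < a) (hb : 0 < b) (hδ : δ ∈ Set.Ioc (1 / 2 : ℝ) 1)
    (θ : EuclideanSpace ℝ (Fin M))
    (z : ℕ → Fin N → Ω → ℝ) (hz : ∀ t i ω, z t i ω = inner ℝ (h i) θ + n t i ω)
    (x₀ : Ω → Fin N → EuclideanSpace ℝ (Fin M)) (i : Fin N) :
    ∀ᵐ ω ∂μ, Tendsto
      (fun t => estimate G a b δ Ψc Ψo h (fun s k => z s k ω) (fun s k j => ξ s k j ω) (x₀ ω) t i)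
      atTop (𝓝 θ) := by
  have hα := fun t => stepSize_nonneg (δ := δ) ha t
  have hα2 := summable_stepSize_sq (a := a) hδ.1
  have hobs : ∀ i, ∀ᵐ ω ∂μ, AveragesTo (stepSize a δ)
      (fun t u => Ψo (u + -1 * n t i ω)) (smoothed Ψo po) := fun i =>
    ae_averagesTo_smoothed hΨo hn.isNoiseDensity (fun t => hn.measurable t i)
      (hn.indep.precomp (g := fun t : ℕ => (t, i)) fun _ _ hst => (Prod.mk.inj hst).1)
      (fun t => hn.hasDensity t i) hα hα2 (Or.inr rfl)
  have heval : ∀ l : Fin M, Measurable fun v : EuclideanSpace ℝ (Fin M) => v l := fun l =>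
    (EuclideanSpace.proj (𝕜 := ℝ) l).measurable
  have hcom : ∃ φc : ℝ → ℝ, Continuous φc ∧ (∀ u, φc (-u) = -φc u) ∧ Monotone φc ∧
      (∀ u, 0 < u → 0 < φc u) ∧ ∀ (d : G.Dart) (l : Fin M), ∀ᵐ ω ∂μ, AveragesTo (stepSize a δ)
        (fun t u => Ψc (u + 1 * ξ t d.fst d.snd ω l)) φc := by
    -- With no communication channel there is no noise variable to certify that `pc` has total mass
    -- `1`, and any odd, monotone, continuous function positive on the positive axis serves as `φc`.
    rcases isEmpty_or_nonempty (G.Dart × Fin M) with hK | ⟨⟨d, l⟩⟩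
    · exact ⟨id, continuous_id, fun _ => rfl, monotone_id, fun _ hu => hu,
        fun d l => (hK.false (d, l)).elim⟩
    have hp := hξ.isNoiseDensity
    have hm := fun t (d : G.Dart) l => (heval l).comp (hξ.measurable t _ _ d.adj)
    obtain ⟨hpi, -⟩ := (hξ.hasDensity 0 _ _ d.adj l).integrable_integral (hm 0 d l) hp
    exact ⟨smoothed Ψc pc, smoothed_continuous hΨc hp hpi, smoothed_odd hΨc hp,
      smoothed_monotone hΨc hp hpi, fun u hu => smoothed_pos hΨc hp hpi hu, fun d l =>
      ae_averagesTo_smoothed hΨc hp (fun t => hm t d l)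
        ((hξ.indep.precomp (g := fun t : ℕ => (t, d)) fun _ _ hst => (Prod.mk.inj hst).1).comp
          (fun _ v => v l) fun _ => heval l)
        (fun t => hξ.hasDensity t _ _ d.adj l) hα hα2 (Or.inl rfl)⟩
  obtain ⟨φc, hφcc, hφcodd, hφcm, hφcpos, hcom⟩ := hcom
  have hpo := hn.isNoiseDensity
  obtain ⟨hpoi, -⟩ := (hn.hasDensity 0 i).integrable_integral (hn.measurable 0 i) hpo
  have hom := smoothed_monotone hΨo hpo hpoi
  have hoodd := smoothed_odd hΨo hpo
  have hopos := fun u hu => smoothed_pos (u := u) hΨo hpo hpoi hu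
  obtain ⟨Lc, -, hLc⟩ := hΨc.bounded
  obtain ⟨Lo, -, hLo⟩ := hΨo.bounded
  have hba : 0 < b / a := div_pos hb ha
  -- Each channel averages on its own almost sure event. There are finitely many channels, so the
  -- events intersect without any assumption on their joint law.
  filter_upwards [ae_all_iff.2 hobs, ae_all_iff.2 fun d => ae_all_iff.2 (hcom d)] with ω hωo hωc
  have hlim := recursion_tendsto_zero (K := Channel G M) (L := max Lc Lo)
    (φ := Sum.elim (fun _ => φc) fun _ => smoothed Ψo po)
    (ψ := Sum.elim (fun q t u => Ψc (u + 1 * ξ t q.1.fst q.1.snd ω q.2))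
      fun j t u => Ψo (u + -1 * n t j ω))
    (Y := fun t => stackedError θ
      (estimate G a b δ Ψc Ψo h (fun s k => z s k ω) (fun s k j => ξ s k j ω) (x₀ ω) t)) hα
    (stepSize_tendsto_zero hδ.1) (stepSize_sum_tendsto_atTop ha hδ.2)
    (by rintro (q | j); exacts [hφcc, smoothed_continuous hΨo hpo hpoi])
    (by
      rintro (q | j) t u
      exacts [(hLc _).trans (le_max_left _ _), (hLo _).trans (le_max_right _ _)])
    (by rintro (⟨d, l⟩ | j); exacts [hωc d l, hωo j])
    (dissipation_channel_smul G h hba hφcodd hφcm hom)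
    (dissipation_channel_pos G h hG hspan hba hφcodd hφcm hφcpos hoodd hom hopos)
    (fun t => stackedError_estimate_succ G h (a := a) (b := b) (δ := δ) (Ψc := Ψc) hΨo
      (fun t j => hz t j ω) (fun s k j => ξ s k j ω) (x₀ ω) t)
  have hcont : Continuous fun y : EuclideanSpace ℝ (Fin N × Fin M) =>
      (WithLp.toLp 2 fun l => y (i, l) + θ l : EuclideanSpace ℝ (Fin M)) := by fun_prop
  have hθ := (hcont.tendsto 0).comp hlim
  simpa [Function.comp_def, stackedError] using hθ
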